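/- Let $G=(V,E)$ be a finite connected plane graph without loops or multiple edges (vertices are distinct points of the plane; edges are simple arcs joining their endpoints, passing through no other vertices, and meeting each other only in common endpoints). Let $\ell$ be a horizontal line, and suppose that the drawing of $G$ is symmetric about $\ell$: the reflection across $\ell$ maps vertices to vertices and edges to edges. Let $w:E\to(0,\infty)$ be a weight function that is constant on the orbits of this reflection. Let $v$ be a vertex of $G$ that lies on $\ell$ and on the boundary of the unbounded face of $G$, and let $v_1,\dotsc,v_n$ be the vertices of $G$ other than $v$ that lie on $\ell$ and are not incident to any edge contained in $\ell$. Choose a random spanning tree $T$ of $G$ with probability proportional to its weight $\prod_{e\in T}w(e)$, and orient all edges of $T$ towards the root $v$, so that every vertex other than $v$ has exactly one outgoing edge. Let $Y_i=1$ if the outgoing edge of $T$ at $v_i$ is situated above $\ell$ (all its points other than its endpoints lie strictly above $\ell$), and $Y_i=0$ otherwise. Then $Y_1,\dotsc,Y_n$ are independent and identically distributed Bernoulli random variables with parameter $1/2$. -/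

import Mathlib

open MeasureTheory ProbabilityTheory

/-- A plane graph with vertex type `V`: a simple graph (no loops, no multiple edges) drawn in the
plane `ℂ`. Vertices are distinct points, each edge is drawn as a simple arc joining its two ends,
an edge passes through no vertex other than its ends, and two distinct edges meet at most in a
common end. Only the values of `arc` at edges of the graph are meaningful. -/
structure PlaneGraph (V : Type*) where
  /-- the underlying abstract graph -/
  graph : SimpleGraph V
  /-- the position of a vertex in the plane -/
  pos : V → ℂ
  /-- the point set of the curve by which an edge is drawn (including its ends) -/
  arc : Sym2 V → Set ℂ
  pos_injective : Function.Injective pos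
  arc_isArc : ∀ x y : V, graph.Adj x y →
    ∃ γ : unitInterval → ℂ, Continuous γ ∧ Function.Injective γ ∧
      γ 0 = pos x ∧ γ 1 = pos y ∧ Set.range γ = arc s(x, y)
  mem_of_pos_mem_arc : ∀ e ∈ graph.edgeSet, ∀ x : V, pos x ∈ arc e → x ∈ e
  arc_inter_arc : ∀ e ∈ graph.edgeSet, ∀ e' ∈ graph.edgeSet, e ≠ e' →
    ∀ z ∈ arc e ∩ arc e', ∃ x : V, x ∈ e ∧ x ∈ e' ∧ pos x = z

namespace PlaneGraph

variable {V : Type*}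

/-- The horizontal symmetry axis `ℓ`, with coordinates chosen so that it is the real axis. -/
def axis : Set ℂ := {z | z.im = 0}

/-- The reflection of the plane across the axis. -/
def reflect (z : ℂ) : ℂ := (starRingEnd ℂ) z

/-- The drawing of `G` is carried to itself by the reflection across the axis: vertices go to
vertices and edges go to edges. -/
structure IsSymmetric (G : PlaneGraph V) : Prop where
  vertex : ∀ x : V, ∃ x' : V, G.pos x' = reflect (G.pos x)
  edge : ∀ e ∈ G.graph.edgeSet, ∃ e' ∈ G.graph.edgeSet, G.arc e' = reflect '' G.arc e

/-- `w` is a (positive) weight function on the edges of `G` that is constant on the orbits of the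
reflection across the axis. -/
structure IsSymmetricWeight (G : PlaneGraph V) (w : Sym2 V → ℝ) : Prop where
  pos : ∀ e ∈ G.graph.edgeSet, 0 < w e
  reflect_eq : ∀ e ∈ G.graph.edgeSet, ∀ e' ∈ G.graph.edgeSet,
    G.arc e' = reflect '' G.arc e → w e' = w e

/-- The set of all points of the plane covered by the drawing of `G`. -/
def drawing (G : PlaneGraph V) : Set ℂ :=
  Set.range G.pos ∪ ⋃ e ∈ G.graph.edgeSet, G.arc e

/-- The faces of `G`: the connected components of the complement of the drawing. -/
def IsFace (G : PlaneGraph V) (F : Set ℂ) : Prop :=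
  ∃ z ∈ G.drawingᶜ, F = connectedComponentIn G.drawingᶜ z

/-- The vertex `x` lies on the (boundary of the) unbounded face. -/
def OnUnboundedFace (G : PlaneGraph V) (x : V) : Prop :=
  ∃ F : Set ℂ, G.IsFace F ∧ ¬ Bornology.IsBounded F ∧ G.pos x ∈ frontier F

/-- The edge `e` is situated above the axis: all its points other than its ends are strictly above
the axis. -/
def IsAbove (G : PlaneGraph V) (e : Sym2 V) : Prop :=
  ∀ z ∈ G.arc e, (∀ x ∈ e, z ≠ G.pos x) → 0 < z.im

/-- The spanning trees of `G`, as subgraphs on the full vertex set. -/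
def SpanningTree (G : PlaneGraph V) : Type _ :=
  {T : SimpleGraph V // T ≤ G.graph ∧ T.IsTree}

instance (G : PlaneGraph V) : MeasurableSpace G.SpanningTree := ⊤

noncomputable instance [Finite V] (G : PlaneGraph V) : Fintype G.SpanningTree :=
  haveI : Finite G.SpanningTree :=
    inferInstanceAs (Finite {T : SimpleGraph V // T ≤ G.graph ∧ T.IsTree})
  Fintype.ofFinite _

open Classical in
/-- The weight of a spanning tree: the product of the weights of its edges. -/
noncomputable def treeWeight [Fintype V] (G : PlaneGraph V) (w : Sym2 V → ℝ)
    (T : G.SpanningTree) : ℝ :=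
  ∏ e ∈ T.1.edgeFinset, w e

/-- The law of a random spanning tree chosen with probability proportional to its weight. -/
noncomputable def treeMeasure [Fintype V] (G : PlaneGraph V) (w : Sym2 V → ℝ) :
    Measure G.SpanningTree :=
  ∑ T : G.SpanningTree,
    ENNReal.ofReal (G.treeWeight w T / ∑ T' : G.SpanningTree, G.treeWeight w T') •
      Measure.dirac T

/-- In the tree `T` with all edges oriented towards the root `v`, the edge from `x` to `y` is the
outgoing edge at `x`: it is the first edge of the path in `T` from `x` to `v`. -/
def IsExit (T : SimpleGraph V) (v x y : V) : Prop :=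
  ∃ (h : T.Adj x y) (p : T.Walk y v), (SimpleGraph.Walk.cons h p).IsPath

/-- The vertices other than the root `v` that lie on the axis and are not incident to an edge
contained in the axis. -/
def FreeAxisVertex (G : PlaneGraph V) (v : V) : Type _ :=
  {x : V // x ≠ v ∧ G.pos x ∈ axis ∧ ∀ e ∈ G.graph.edgeSet, x ∈ e → ¬ G.arc e ⊆ axis}

open Classical in
/-- The indicator random variable of the event that, in the random spanning tree rooted at `v`, the
vertex `x` is exited along an edge above the axis. -/
noncomputable def exitAbove (G : PlaneGraph V) (v x : V) (T : G.SpanningTree) : ℝ :=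
  if ∃ y : V, IsExit T.1 v x y ∧ G.IsAbove s(x, y) then 1 else 0

end PlaneGraph

/-!
The independence comes from a symmetry of determinants. By the matrix-tree theorem for trees rooted
at `v` (`sum_tree_eq_det`), the total weight of the spanning trees whose exits at the free axis
vertices lie on prescribed sides of the axis is the determinant of a Laplacian in which the row of
a free axis vertex only keeps the edges on the prescribed side. Reversing the prescribed side at one
vertex `i` replaces the row of `i` by its mirror image, so that the two determinants differ by the
determinant of a matrix whose row at `i` is antisymmetric under the reflection. That
matrix is singular (`det_eq_zero_of_antisymmetric_row`): if `U` is the set of vertices strictly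
above the axis, then the differences of the rows of mirror vertices, together with the row of `i`,
are `|U| + 1` vectors in the `|U|`-dimensional space of antisymmetric vectors, and hence dependent.
So all `2 ^ n` patterns of exits have the same weight (`patternWeight_update`), which says that the
exits are independent and fair.

Geometry enters only in showing that an edge at a free axis vertex lies on one side of the axis and
is exchanged with an edge on the other side (`IsSymmetric.isAbove_mirror_iff`). If such an edge met
the axis in an interior point, it would share that point with its mirror image and so be equal to
it; the reflection would then be an involution of an arc fixing both ends, hence the identity
(`eq_self_of_mem_arc`), and the edge would lie in the axis.

The matrix-tree theorem is proved by expanding the determinant along the choice of one step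
`x ↦ f x` at each vertex: the determinant attached to a choice `f` is `1` if all iterates lead to
the root, and `0` otherwise, and the choices leading to the root are the exit maps of the rooted
trees.
-/

/-! ### Determinants of rooted Laplacians -/

section Determinant

open scoped Matrix

variable {V : Type*} [Fintype V] [DecidableEq V]

/-- Every point reaches `v` under iteration of `f`. -/
def LeadsTo (f : V → V) (v : V) : Prop := ∀ x, ∃ n, f^[n] x = v

/-- The row attached to a step from `x` to `y` when `v` is the root: `1_x - 1_y`, except that the
row of the root itself is `1_v`. -/
def stepRow (v x y : V) : V → ℝ :=
  if x = v then Pi.single v 1 else Pi.single x 1 - Pi.single y 1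

/-- The weighted Laplacian of the step weights `c`, with the row of the root `v` replaced by a
multiple of `1_v`. Keeping a row for the root avoids passing to the type `{x // x ≠ v}`. -/
def rootedLaplacian (v : V) (c : V → V → ℝ) : Matrix V V ℝ :=
  Matrix.of fun x => ∑ y, c x y • stepRow v x y

theorem det_stepRow_of_leadsTo {f : V → V} {v : V} (hf : LeadsTo f v) :
    (Matrix.of fun x => stepRow v x (f x)).det = 1 := by
  classical
  -- Order the vertices by the number of steps they need to reach the root.
  let d : V → ℕ := fun x => Nat.find (hf x)
  have hd : ∀ x, x ≠ v → d (f x) < d x := by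
    intro x hx
    have h1 : f^[d x] x = v := Nat.find_spec (hf x)
    rcases h : d x with _ | k
    · rw [h] at h1; exact absurd h1 hx
    · rw [h, Function.iterate_succ_apply] at h1
      exact Nat.lt_succ_of_le (Nat.find_min' (hf (f x)) h1)
  have hne : ∀ x y, x ≠ y → d x ≤ d y → stepRow v x (f x) y = 0 := by
    intro x y hxy hle
    by_cases hx : x = v
    · simp [stepRow, hx, (hx ▸ hxy : v ≠ y).symm]
    · have : y ≠ f x := by rintro rfl; exact absurd (hd x hx) (by omega)
      simp [stepRow, hx, hxy.symm, this]
  have hdiag : ∀ x, stepRow v x (f x) x = 1 := by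
    intro x
    by_cases hx : x = v
    · simp [stepRow, hx]
    · have : x ≠ f x := by intro h; have := hd x hx; rw [← h] at this; omega
      simp [stepRow, hx, this]
  have hbt : (Matrix.of fun x => stepRow v x (f x)).BlockTriangular
      (fun x => OrderDual.toDual (d x)) := by
    intro x y hxy
    have hxy : d x < d y := hxy
    exact hne x y (by rintro rfl; omega) hxy.le
  rw [hbt.det]
  refine Finset.prod_eq_one fun a _ => ?_
  have : (Matrix.of fun x => stepRow v x (f x)).toSquareBlock
      (fun x => OrderDual.toDual (d x)) a = 1 := by
    ext x y
    by_cases hxy : x = y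
    · subst hxy; simp [Matrix.toSquareBlock_def, hdiag]
    · have h1 : d x.1 = d y.1 := by
        have := x.2.trans y.2.symm
        simpa using this
      simp only [Matrix.toSquareBlock_def, Matrix.of_apply, Matrix.one_apply_ne hxy]
      exact hne _ _ (fun h => hxy (Subtype.ext h)) h1.le
  rw [this, Matrix.det_one]

theorem det_stepRow_of_not_leadsTo {f : V → V} {v : V} (hf : ¬ LeadsTo f v) :
    (Matrix.of fun x => stepRow v x (f x)).det = 0 := by
  classical
  -- The indicator of the set of vertices that never reach the root lies in the kernel.
  let h : V → ℝ := fun x => if ∃ n, f^[n] x = v then 0 else 1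
  refine Matrix.exists_mulVec_eq_zero_iff.1 ⟨h, ?_, ?_⟩
  · intro h0
    refine hf fun x => ?_
    by_contra hx
    have := congrFun h0 x
    simp [h, hx] at this
  · have hv : h v = 0 := if_pos ⟨0, rfl⟩
    ext x
    by_cases hx : x = v
    · simp [Matrix.mulVec, stepRow, hx, hv]
    · have hfx : h (f x) = h x := by
        have : (∃ n, f^[n] (f x) = v) ↔ ∃ n, f^[n] x = v := by
          constructor
          · rintro ⟨n, hn⟩; exact ⟨n + 1, hn⟩
          · rintro ⟨_ | n, hn⟩
            · exact absurd hn hx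
            · exact ⟨n, hn⟩
        simp only [h, this]
      have hrow : stepRow v x (f x) = Pi.single x 1 - Pi.single (f x) 1 := if_neg hx
      change stepRow v x (f x) ⬝ᵥ h = 0
      rw [hrow, sub_dotProduct]
      simp [hfx]

open Classical in
/-- The directed matrix-tree theorem, with rooted trees encoded by their parent maps. -/
theorem det_rootedLaplacian (v : V) (c : V → V → ℝ) :
    (rootedLaplacian v c).det = ∑ f : V → V with LeadsTo f v, ∏ x, c x (f x) := by
  have h := (Matrix.detRowAlternating (n := V) (R := ℝ)).toMultilinearMap.map_sum
    (fun x y => c x y • stepRow v x y)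
  have h' : (rootedLaplacian v c).det =
      ∑ f : V → V, (∏ x, c x (f x)) * (Matrix.of fun x => stepRow v x (f x)).det := by
    refine Eq.trans h (Finset.sum_congr rfl fun f _ => ?_)
    rw [MultilinearMap.map_smul_univ]
    rfl
  rw [h', Finset.sum_filter]
  refine Finset.sum_congr rfl fun f _ => ?_
  split_ifs with hf
  · rw [det_stepRow_of_leadsTo hf, mul_one]
  · rw [det_stepRow_of_not_leadsTo hf, mul_zero]

/-- A matrix commuting with an involution `σ` off the fixed points of `σ`, one of whose rows at a
fixed point is antisymmetric, is singular: the antisymmetric combinations of the rows,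
together with that row, are one too many for the space of antisymmetric vectors they lie in. -/
theorem det_eq_zero_of_antisymmetric_row {σ : V → V} (hσ : Function.Involutive σ)
    (M : Matrix V V ℝ) (hM : ∀ x, σ x ≠ x → ∀ y, M (σ x) (σ y) = M x y)
    {i : V} (hi : σ i = i) (hrow : ∀ y, M i (σ y) = - M i y) : M.det = 0 := by
  classical
  let O : Submodule ℝ (V → ℝ) :=
    { carrier := {g | ∀ y, g (σ y) = - g y}
      add_mem' := by intro a b ha hb y; simp [ha y, hb y]; ring
      zero_mem' := by intro y; simp
      smul_mem' := by intro r a ha y; simp [ha y] }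
  have hfix : ∀ g ∈ O, ∀ x, σ x = x → g x = 0 := by
    intro g hg x hx
    have := hg x
    rw [hx] at this
    linarith
  have hodd : ∀ g ∈ O, Matrix.vecMul g M ∈ O := by
    intro g hg y
    simp only [Matrix.vecMul, dotProduct]
    rw [← Finset.sum_neg_distrib, ← Equiv.sum_comp (hσ.toPerm σ)]
    refine Finset.sum_congr rfl fun x _ => ?_
    simp only [Function.Involutive.coe_toPerm]
    by_cases hx : σ x = x
    · rw [hx, hfix g hg x hx]; simp
    · rw [hg x, hM x hx]; ring
  let L : (O × ℝ) →ₗ[ℝ] (V → ℝ) :=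
    O.subtype.coprod (LinearMap.toSpanSingleton ℝ (V → ℝ) (Pi.single i 1))
  have hL : ∀ p, (Matrix.vecMulLinear M) (L p) ∈ O := by
    rintro ⟨g, t⟩
    have h1 : (Matrix.vecMulLinear M) (L (g, t)) = Matrix.vecMul g.1 M + t • M i := by
      simp [L]
      rfl
    rw [h1]
    exact O.add_mem (hodd _ g.2) (O.smul_mem _ hrow)
  let N : (O × ℝ) →ₗ[ℝ] O := ((Matrix.vecMulLinear M).comp L).codRestrict O hL
  have hker : N.ker ≠ ⊥ := LinearMap.ker_ne_bot_of_finrank_lt (by simp)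
  obtain ⟨⟨g, t⟩, hp, hne⟩ := Submodule.exists_mem_ne_zero_of_ne_bot hker
  refine Matrix.exists_vecMul_eq_zero_iff.1 ⟨L (g, t), fun h0 => hne ?_, ?_⟩
  · have ht : t = 0 := by
      have := congrFun h0 i
      simpa [L, hfix g.1 g.2 i hi] using this
    subst ht
    have : g.1 = 0 := by simpa [L] using h0
    ext1
    · exact Subtype.ext this
    · rfl
  · exact congrArg Subtype.val hp

/-- Reflecting the step weights at one fixed point of a symmetry does not change the
determinant. -/
theorem det_rootedLaplacian_eq_of_reflect {σ : V → V} (hσ : Function.Involutive σ) {v : V}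
    (hv : σ v = v) {c c' : V → V → ℝ} (hc : ∀ x, σ x ≠ x → ∀ y, c (σ x) (σ y) = c x y)
    {i : V} (hiv : i ≠ v) (hi : σ i = i) (hci : ∀ y, c' i y = c i (σ y))
    (hcc' : ∀ x, x ≠ i → ∀ y, c' x y = c x y) :
    (rootedLaplacian v c').det = (rootedLaplacian v c).det := by
  have hstep : ∀ x y z, stepRow v (σ x) (σ y) (σ z) = stepRow v x y z := by
    intro x y z
    have h1 : σ x = v ↔ x = v := by rw [← hσ.injective.eq_iff (a := x), hv]
    have h2 : σ z = v ↔ z = v := by rw [← hσ.injective.eq_iff (a := z), hv]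
    by_cases hx : x = v
    · simp [stepRow, hx, hv, Pi.single_apply, h2]
    · simp [stepRow, hx, h1, Pi.single_apply, hσ.injective.eq_iff]
  have hL : ∀ (c : V → V → ℝ) x z, rootedLaplacian v c x z = ∑ y, c x y * stepRow v x y z := by
    intro c x z; simp [rootedLaplacian]
  have hci' : ∀ z, rootedLaplacian v c' i (σ z) = rootedLaplacian v c i z := by
    intro z
    rw [hL, hL, ← Equiv.sum_comp (hσ.toPerm σ)]
    refine Finset.sum_congr rfl fun y _ => ?_
    have := hstep i y z
    rw [hi] at this
    simp only [Function.Involutive.coe_toPerm]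
    rw [hci, hσ y, this]
  have hup : rootedLaplacian v c' =
      (rootedLaplacian v c).updateRow i
        (rootedLaplacian v c i + (rootedLaplacian v c' i - rootedLaplacian v c i)) := by
    ext x z
    by_cases hx : x = i
    · subst hx; simp
    · rw [Matrix.updateRow_ne hx, hL, hL]
      simp [hcc' x hx]
  rw [hup, Matrix.det_updateRow_add, Matrix.updateRow_eq_self]
  refine add_eq_left.2 (det_eq_zero_of_antisymmetric_row hσ _ ?_ hi ?_)
  · intro x hx y
    have hxi : x ≠ i := by rintro rfl; exact hx hi
    have hsxi : σ x ≠ i := by intro h; apply hxi; rw [← hσ x, h, hi]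
    rw [Matrix.updateRow_ne hxi, Matrix.updateRow_ne hsxi, hL, hL, ← Equiv.sum_comp (hσ.toPerm σ)]
    refine Finset.sum_congr rfl fun z _ => ?_
    simp only [Function.Involutive.coe_toPerm]
    rw [hc x hx, hstep]
  · intro y
    have := hci' (σ y)
    rw [hσ y] at this
    simp [hci' y, this]

end Determinant

/-! ### Rooted spanning trees -/

section Trees

namespace PlaneGraph

open SimpleGraph

variable {V : Type*}

theorem IsExit.unique {T : SimpleGraph V} (hT : T.IsTree) {v x y z : V}
    (hy : IsExit T v x y) (hz : IsExit T v x z) : y = z := by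
  obtain ⟨h, p, hp⟩ := hy
  obtain ⟨h', q, hq⟩ := hz
  have := (hT.existsUnique_path x v).unique hp hq
  simpa using congrArg Walk.snd this

theorem exists_isExit {T : SimpleGraph V} (hT : T.IsTree) {v x : V} (hx : x ≠ v) :
    ∃ y, IsExit T v x y := by
  obtain ⟨p, hp, -⟩ := hT.existsUnique_path x v
  cases p with
  | nil => exact absurd rfl hx
  | cons h p => exact ⟨_, h, p, hp⟩

theorem IsExit.ne {T : SimpleGraph V} {v x y : V} (h : IsExit T v x y) : x ≠ v := by
  obtain ⟨h, p, hp⟩ := h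
  rintro rfl
  exact ((Walk.cons_isPath_iff _ _).1 hp).2 p.end_mem_support

/-- A map whose graph follows the exits of a tree leads to the root. -/
theorem leadsTo_of_isExit {T : SimpleGraph V} (hT : T.IsTree) {v : V} {f : V → V}
    (hf : ∀ x, x ≠ v → IsExit T v x (f x)) : LeadsTo f v := by
  have key : ∀ x u (p : T.Walk x u), u = v → p.IsPath → ∃ n, f^[n] x = v := by
    intro x u p hu hp
    induction p with
    | nil => exact ⟨0, hu⟩
    | @cons a b c h p ih =>
      have hex : IsExit T v a b := hu ▸ ⟨h, p, hp⟩
      obtain ⟨n, hn⟩ := ih hu hp.of_cons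
      refine ⟨n + 1, ?_⟩
      rw [Function.iterate_succ_apply, (hf a hex.ne).unique hT hex, hn]
  intro x
  obtain ⟨p, hp, -⟩ := hT.existsUnique_path x v
  exact key x v p rfl hp

/-- The undirected graph with an edge between `x` and `f x` for each `x`. -/
def functionalGraph (f : V → V) : SimpleGraph V := SimpleGraph.fromRel fun x y => f x = y

theorem functionalGraph_adj {f : V → V} {x y : V} :
    (functionalGraph f).Adj x y ↔ x ≠ y ∧ (f x = y ∨ f y = x) := by
  simp [functionalGraph]

theorem functionalGraph_le {f : V → V} {v : V} {H : SimpleGraph V} (hv : f v = v)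
    (hf : ∀ x, x ≠ v → H.Adj x (f x)) : functionalGraph f ≤ H := by
  intro x y hxy
  obtain ⟨hne, rfl | rfl⟩ := functionalGraph_adj.1 hxy
  · exact hf x (by rintro rfl; exact hne hv.symm)
  · exact (hf y (by rintro rfl; exact hne hv)).symm

theorem functionalGraph_connected {f : V → V} {v : V} (hf : LeadsTo f v) :
    (functionalGraph f).Connected := by
  have hstep : ∀ x, (functionalGraph f).Reachable x (f x) := by
    intro x
    by_cases h : x = f x
    · rw [← h]
    · exact (functionalGraph_adj.2 ⟨h, Or.inl rfl⟩).reachable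
  have hit : ∀ n x, (functionalGraph f).Reachable x (f^[n] x) := by
    intro n
    induction n with
    | zero => intro x; exact Reachable.rfl
    | succ n ih => intro x; exact (hstep x).trans (ih (f x))
  have hroot : ∀ x, (functionalGraph f).Reachable x v := by
    intro x
    obtain ⟨n, hn⟩ := hf x
    exact hn ▸ hit n x
  exact (connected_iff_exists_forall_reachable _).2 ⟨v, fun x => (hroot x).symm⟩

theorem iterate_succ_ne_self {f : V → V} {v : V} (hv : f v = v) (hf : LeadsTo f v) {x : V}
    (hx : x ≠ v) (k : ℕ) : f^[k + 1] x ≠ x := by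
  intro h
  obtain ⟨n, hn⟩ := hf x
  have h1 : f^[(k + 1) * n] x = x := by
    rw [Function.iterate_mul]
    exact Function.iterate_fixed h n
  have h2 : (k + 1) * n = k * n + n := by ring
  rw [h2, Function.iterate_add_apply, hn, Function.iterate_fixed hv] at h1
  exact hx h1.symm

theorem isExit_functionalGraph {f : V → V} {v : V} (hv : f v = v) (hf : LeadsTo f v) {x : V}
    (hx : x ≠ v) : IsExit (functionalGraph f) v x (f x) := by
  classical
  have key : ∀ n y, f^[n] y = v →
      ∃ p : (functionalGraph f).Walk y v, ∀ u ∈ p.support, ∃ k, f^[k] y = u := by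
    intro n
    induction n with
    | zero =>
      rintro y rfl
      exact ⟨Walk.nil, fun u hu => ⟨0, (List.mem_singleton.1 hu).symm⟩⟩
    | succ n ih =>
      intro y hy
      obtain ⟨p, hp⟩ := ih (f y) hy
      by_cases h : y = f y
      · refine ⟨p.copy h.symm rfl, fun u hu => ?_⟩
        rw [Walk.support_copy] at hu
        obtain ⟨k, hk⟩ := hp u hu
        exact ⟨k + 1, hk⟩
      · refine ⟨Walk.cons (functionalGraph_adj.2 ⟨h, Or.inl rfl⟩) p, fun u hu => ?_⟩
        rw [Walk.support_cons, List.mem_cons] at hu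
        rcases hu with rfl | hu
        · exact ⟨0, rfl⟩
        · obtain ⟨k, hk⟩ := hp u hu
          exact ⟨k + 1, hk⟩
  obtain ⟨n, hn⟩ := hf (f x)
  obtain ⟨p, hp⟩ := key n (f x) hn
  have hadj : (functionalGraph f).Adj x (f x) :=
    functionalGraph_adj.2 ⟨(iterate_succ_ne_self hv hf hx 0).symm, Or.inl rfl⟩
  refine ⟨hadj, p.bypass, (Walk.cons_isPath_iff _ _).2 ⟨p.bypass_isPath, fun hmem => ?_⟩⟩
  obtain ⟨k, hk⟩ := hp x (p.support_bypass_subset_support hmem)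
  exact iterate_succ_ne_self hv hf hx k hk

variable [Fintype V]

open Classical in
theorem edgeFinset_functionalGraph {f : V → V} {v : V} (hv : f v = v) (hf : LeadsTo f v) :
    (functionalGraph f).edgeFinset = (Finset.univ.erase v).image fun x => s(x, f x) := by
  ext e
  induction e with
  | _ x y =>
    simp only [mem_edgeFinset, mem_edgeSet, functionalGraph_adj, Finset.mem_image,
      Finset.mem_erase, Finset.mem_univ, and_true]
    constructor
    · rintro ⟨hne, rfl | rfl⟩
      · exact ⟨x, by rintro rfl; exact hne hv.symm, rfl⟩
      · exact ⟨y, by rintro rfl; exact hne hv, Sym2.eq_swap⟩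
    · rintro ⟨a, ha, hxy⟩
      have hne := iterate_succ_ne_self hv hf ha 0
      rw [Function.iterate_one] at hne
      rcases Sym2.eq_iff.1 hxy with ⟨rfl, rfl⟩ | ⟨rfl, rfl⟩
      · exact ⟨hne.symm, Or.inl rfl⟩
      · exact ⟨hne, Or.inr rfl⟩

open Classical in
theorem card_edgeFinset_functionalGraph {f : V → V} {v : V} (hv : f v = v) (hf : LeadsTo f v) :
    (functionalGraph f).edgeFinset.card = (Finset.univ.erase v).card := by
  have h1 : (functionalGraph f).edgeFinset.card ≤ (Finset.univ.erase v).card := by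
    rw [edgeFinset_functionalGraph hv hf]; exact Finset.card_image_le
  have h2 := (functionalGraph_connected hf).card_vert_le_card_edgeSet_add_one
  rw [Nat.card_eq_fintype_card, Nat.card_eq_fintype_card, ← edgeFinset_card] at h2
  have h3 := Finset.card_erase_add_one (Finset.mem_univ v)
  rw [Finset.card_univ] at h3
  omega

theorem functionalGraph_isTree {f : V → V} {v : V} (hv : f v = v) (hf : LeadsTo f v) :
    (functionalGraph f).IsTree := by
  classical
  refine isTree_iff_connected_and_card.2 ⟨functionalGraph_connected hf, ?_⟩
  rw [Nat.card_eq_fintype_card, Nat.card_eq_fintype_card, ← edgeFinset_card,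
    card_edgeFinset_functionalGraph hv hf, Finset.card_erase_add_one (Finset.mem_univ v),
    Finset.card_univ]

open Classical in
theorem prod_edgeFinset_functionalGraph {f : V → V} {v : V} (hv : f v = v) (hf : LeadsTo f v)
    (w : Sym2 V → ℝ) :
    ∏ e ∈ (functionalGraph f).edgeFinset, w e = ∏ x ∈ Finset.univ.erase v, w s(x, f x) := by
  have hinj : Set.InjOn (fun x => s(x, f x)) (Finset.univ.erase v : Finset V) := by
    rw [← Finset.card_image_iff, ← edgeFinset_functionalGraph hv hf,
      card_edgeFinset_functionalGraph hv hf]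
  rw [edgeFinset_functionalGraph hv hf, Finset.prod_image hinj]

open Classical in
/-- The step weights that describe the spanning trees of `H` rooted at `v` all of whose exits are
allowed by `ok`. -/
noncomputable def stepWeight (H : SimpleGraph V) (w : Sym2 V → ℝ) (v : V) (ok : V → V → Prop)
    (x y : V) : ℝ :=
  if x = v then (if y = v then 1 else 0) else if H.Adj x y ∧ ok x y then w s(x, y) else 0

open Classical in
/-- The matrix-tree theorem for spanning trees with prescribed exits. -/
theorem sum_tree_eq_det (H : SimpleGraph V) (w : Sym2 V → ℝ) (v : V) (ok : V → V → Prop) :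
    ∑ T : SimpleGraph V with (T ≤ H ∧ T.IsTree) ∧ ∀ x y, IsExit T v x y → ok x y,
      ∏ e ∈ T.edgeFinset, w e = (rootedLaplacian v (stepWeight H w v ok)).det := by
  rw [det_rootedLaplacian]
  have hsub : (Finset.univ.filter fun f : V → V =>
      LeadsTo f v ∧ f v = v ∧ ∀ x, x ≠ v → H.Adj x (f x) ∧ ok x (f x)) ⊆
      Finset.univ.filter fun f : V → V => LeadsTo f v :=
    Finset.monotone_filter_right _ fun f _ h => h.1
  rw [← Finset.sum_subset hsub]
  · symm
    refine Finset.sum_bij (fun f _ => functionalGraph f) ?_ ?_ ?_ ?_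
    · intro f hf
      obtain ⟨hl, hv, hf⟩ := (Finset.mem_filter.1 hf).2
      refine Finset.mem_filter.2 ⟨Finset.mem_univ _, ⟨functionalGraph_le hv fun x hx => (hf x hx).1,
        functionalGraph_isTree hv hl⟩, fun x y hxy => ?_⟩
      rw [hxy.unique (functionalGraph_isTree hv hl) (isExit_functionalGraph hv hl hxy.ne)]
      exact (hf x hxy.ne).2
    · intro f hf g hg hfg
      obtain ⟨hl, hv, hf⟩ := (Finset.mem_filter.1 hf).2
      obtain ⟨hl', hv', hg⟩ := (Finset.mem_filter.1 hg).2
      ext x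
      by_cases hx : x = v
      · rw [hx, hv, hv']
      · have h := isExit_functionalGraph hv' hl' hx
        have hfg : functionalGraph f = functionalGraph g := hfg
        rw [← hfg] at h
        exact (isExit_functionalGraph hv hl hx).unique (functionalGraph_isTree hv hl) h
    · intro T hT
      obtain ⟨⟨hle, hT⟩, hok⟩ := (Finset.mem_filter.1 hT).2
      choose! f hf using fun x (hx : x ≠ v) => exists_isExit hT hx
      let g : V → V := Function.update f v v
      have hv : g v = v := by simp [g]
      have hg : ∀ x, x ≠ v → IsExit T v x (g x) := by
        intro x hx
        simpa [g, hx] using hf x hx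
      have hl : LeadsTo g v := leadsTo_of_isExit hT hg
      refine ⟨g, Finset.mem_filter.2 ⟨Finset.mem_univ _, hl, hv, fun x hx =>
        ⟨hle (hg x hx).1, hok _ _ (hg x hx)⟩⟩, ?_⟩
      -- A connected subgraph of a tree on all the vertices is the whole tree.
      have hgT : functionalGraph g ≤ T := functionalGraph_le hv fun x hx => (hg x hx).1
      exact le_antisymm hgT
        ((isTree_iff_minimal_connected.1 hT).2 (functionalGraph_connected hl) hgT)
    · intro f hf
      obtain ⟨hl, hv, hf⟩ := (Finset.mem_filter.1 hf).2
      rw [prod_edgeFinset_functionalGraph hv hl, ← Finset.mul_prod_erase _ _ (Finset.mem_univ v)]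
      rw [stepWeight, if_pos rfl, if_pos hv, one_mul]
      refine Finset.prod_congr rfl fun x hx => ?_
      have hx := Finset.ne_of_mem_erase hx
      rw [stepWeight, if_neg hx, if_pos (hf x hx)]
  · intro f hf hf'
    have hl := (Finset.mem_filter.1 hf).2
    by_contra hne
    rw [Finset.prod_eq_zero_iff] at hne
    push Not at hne
    refine hf' (Finset.mem_filter.2 ⟨Finset.mem_univ _, hl, ?_, fun x hx => ?_⟩)
    · by_contra h
      exact hne v (Finset.mem_univ _) (by rw [stepWeight, if_pos rfl, if_neg h])
    · by_contra h
      exact hne x (Finset.mem_univ _) (by rw [stepWeight, if_neg hx, if_neg h])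

end PlaneGraph

end Trees

/-! ### Edges at the axis -/

section Geometry

/-- An arc that is carried to itself by an involution fixing both its ends is fixed pointwise:
in the parameter of the arc, the involution is an increasing involution of the interval. -/
theorem eq_self_of_mem_arc {X : Type*} [TopologicalSpace X] [T2Space X] {γ : unitInterval → X}
    (hγ : Continuous γ) (hinj : Function.Injective γ) {ρ : X → X} (hρ : Continuous ρ)
    (hinv : Function.Involutive ρ) (himg : ρ '' Set.range γ = Set.range γ)
    (h0 : ρ (γ 0) = γ 0) (h1 : ρ (γ 1) = γ 1) (t : unitInterval) : ρ (γ t) = γ t := by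
  have hex : ∀ t, ∃ s, γ s = ρ (γ t) := by
    intro t
    have : ρ (γ t) ∈ ρ '' Set.range γ := ⟨_, ⟨t, rfl⟩, rfl⟩
    rwa [himg] at this
  choose h hh using hex
  have hemb : Topology.IsEmbedding γ := (hγ.isClosedEmbedding hinj).isEmbedding
  have hcont : Continuous h := by
    rw [hemb.continuous_iff]
    have : γ ∘ h = ρ ∘ γ := funext hh
    rw [this]
    exact hρ.comp hγ
  have hhinv : Function.Involutive h := by
    intro t
    apply hinj
    rw [hh, hh, hinv]
  have h00 : h 0 = 0 := hinj (by rw [hh, h0])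
  have h11 : h 1 = 1 := hinj (by rw [hh, h1])
  have hmono : StrictMono h := by
    rcases hcont.strictMono_of_inj hhinv.injective with hm | hm
    · exact hm
    · have := hm (show (0 : unitInterval) < 1 from zero_lt_one)
      rw [h00, h11] at this
      exact absurd this (not_lt.2 zero_le_one)
  have hid : h t = t := by
    rcases lt_trichotomy (h t) t with hlt | heq | hgt
    · have := hmono hlt
      rw [hhinv t] at this
      exact absurd hlt this.asymm
    · exact heq
    · have := hmono hgt
      rw [hhinv t] at this
      exact absurd hgt this.asymm
  rw [← hh, hid]

namespace PlaneGraph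

variable {V : Type*} {G : PlaneGraph V}

theorem reflect_involutive : Function.Involutive reflect := fun z => Complex.conj_conj z

theorem reflect_eq_self_iff {z : ℂ} : reflect z = z ↔ z.im = 0 := Complex.conj_eq_iff_im

theorem reflect_im (z : ℂ) : (reflect z).im = -z.im := Complex.conj_im z

/-- The permutation of the vertices induced by the reflection across the axis. -/
noncomputable def IsSymmetric.mirror (h : G.IsSymmetric) (x : V) : V := (h.vertex x).choose

theorem IsSymmetric.pos_mirror (h : G.IsSymmetric) (x : V) :
    G.pos (h.mirror x) = reflect (G.pos x) := (h.vertex x).choose_spec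

theorem IsSymmetric.mirror_involutive (h : G.IsSymmetric) : Function.Involutive h.mirror := by
  intro x
  apply G.pos_injective
  rw [h.pos_mirror, h.pos_mirror, reflect_involutive]

theorem IsSymmetric.mirror_eq_self_iff (h : G.IsSymmetric) {x : V} :
    h.mirror x = x ↔ G.pos x ∈ axis := by
  rw [← G.pos_injective.eq_iff, h.pos_mirror, reflect_eq_self_iff]
  rfl

theorem pos_left_mem_arc {x y : V} (hxy : G.graph.Adj x y) : G.pos x ∈ G.arc s(x, y) := by
  obtain ⟨γ, -, -, h0, -, hr⟩ := G.arc_isArc x y hxy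
  exact hr ▸ h0 ▸ Set.mem_range_self _

theorem pos_right_mem_arc {x y : V} (hxy : G.graph.Adj x y) : G.pos y ∈ G.arc s(x, y) := by
  obtain ⟨γ, -, -, -, h1, hr⟩ := G.arc_isArc x y hxy
  exact hr ▸ h1 ▸ Set.mem_range_self _

/-- The reflection carries the edge `xy` to the edge between the mirror images of `x` and `y`. -/
theorem IsSymmetric.adj_mirror_and_arc (h : G.IsSymmetric) {x y : V} (hxy : G.graph.Adj x y) :
    G.graph.Adj (h.mirror x) (h.mirror y) ∧
      G.arc s(h.mirror x, h.mirror y) = reflect '' G.arc s(x, y) := by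
  obtain ⟨e', he', harc⟩ := h.edge s(x, y) hxy
  have hx : h.mirror x ∈ e' := G.mem_of_pos_mem_arc e' he' _ <| by
    rw [harc, h.pos_mirror]; exact ⟨_, pos_left_mem_arc hxy, rfl⟩
  have hy : h.mirror y ∈ e' := G.mem_of_pos_mem_arc e' he' _ <| by
    rw [harc, h.pos_mirror]; exact ⟨_, pos_right_mem_arc hxy, rfl⟩
  have hne : h.mirror x ≠ h.mirror y := h.mirror_involutive.injective.ne hxy.ne
  have he : e' = s(h.mirror x, h.mirror y) := (Sym2.mem_and_mem_iff hne).1 ⟨hx, hy⟩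
  subst he
  exact ⟨he', harc⟩

theorem IsSymmetric.adj_mirror_iff (h : G.IsSymmetric) {x y : V} :
    G.graph.Adj (h.mirror x) (h.mirror y) ↔ G.graph.Adj x y := by
  refine ⟨fun hxy => ?_, fun hxy => (h.adj_mirror_and_arc hxy).1⟩
  have := (h.adj_mirror_and_arc hxy).1
  rwa [h.mirror_involutive, h.mirror_involutive] at this

/-- An edge with an end on the axis that is not contained in the axis meets the axis in its ends
only. -/
theorem IsSymmetric.im_ne_zero_of_mem_arc (h : G.IsSymmetric) {x y : V} (hxy : G.graph.Adj x y)
    (hx : G.pos x ∈ axis) (hna : ¬ G.arc s(x, y) ⊆ axis) {z : ℂ} (hz : z ∈ G.arc s(x, y))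
    (hzx : z ≠ G.pos x) (hzy : z ≠ G.pos y) : z.im ≠ 0 := by
  intro hz0
  obtain ⟨hadj, harc⟩ := h.adj_mirror_and_arc hxy
  have hz' : z ∈ G.arc s(h.mirror x, h.mirror y) := by
    rw [harc]; exact ⟨z, hz, reflect_eq_self_iff.2 hz0⟩
  have hmx : h.mirror x = x := h.mirror_eq_self_iff.2 hx
  -- A second edge through `z` would meet `xy` away from its ends.
  have he : s(x, y) = s(h.mirror x, h.mirror y) := by
    by_contra hne
    obtain ⟨u, hu, -, huz⟩ := G.arc_inter_arc _ hxy _ hadj hne z ⟨hz, hz'⟩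
    rcases Sym2.mem_iff.1 hu with rfl | rfl
    · exact hzx huz.symm
    · exact hzy huz.symm
  have hmy : h.mirror y = y := by
    rw [hmx] at he
    exact (Sym2.congr_right.1 he).symm
  obtain ⟨γ, hγ, hinj, h0, h1, hr⟩ := G.arc_isArc x y hxy
  refine hna ?_
  rw [← he, ← hr] at harc
  rw [← hr]
  rintro _ ⟨t, rfl⟩
  refine reflect_eq_self_iff.1 (eq_self_of_mem_arc hγ hinj Complex.continuous_conj
    reflect_involutive harc.symm ?_ ?_ t)
  · change reflect _ = _
    rw [h0, ← h.pos_mirror, hmx]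
  · change reflect _ = _
    rw [h1, ← h.pos_mirror, hmy]

/-- An edge that leaves a point of the axis without running inside the axis lies on one side of
it. -/
theorem IsSymmetric.isAbove_or_below (h : G.IsSymmetric) {x y : V} (hxy : G.graph.Adj x y)
    (hx : G.pos x ∈ axis) (hna : ¬ G.arc s(x, y) ⊆ axis) :
    G.IsAbove s(x, y) ∨ ∀ z ∈ G.arc s(x, y), z ≠ G.pos x → z ≠ G.pos y → z.im < 0 := by
  obtain ⟨γ, hγ, hinj, h0, h1, hr⟩ := G.arc_isArc x y hxy
  have hne : ∀ t ∈ Set.Ioo (0 : unitInterval) 1, (γ t).im ≠ 0 := by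
    intro t ht
    refine h.im_ne_zero_of_mem_arc hxy hx hna (hr ▸ Set.mem_range_self t) ?_ ?_
    · rw [← h0]; exact hinj.ne ht.1.ne'
    · rw [← h1]; exact hinj.ne ht.2.ne
  have hpar : ∀ z ∈ G.arc s(x, y), z ≠ G.pos x → z ≠ G.pos y →
      ∃ t ∈ Set.Ioo (0 : unitInterval) 1, γ t = z := by
    intro z hz hzx hzy
    rw [← hr] at hz
    obtain ⟨t, rfl⟩ := hz
    refine ⟨t, ⟨?_, ?_⟩, rfl⟩
    · exact lt_of_le_of_ne bot_le (by rintro rfl; exact hzx h0)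
    · exact lt_of_le_of_ne le_top (by rintro rfl; exact hzy h1)
  have hsign : (∀ t ∈ Set.Ioo (0 : unitInterval) 1, 0 < (γ t).im) ∨
      ∀ t ∈ Set.Ioo (0 : unitInterval) 1, (γ t).im < 0 := by
    by_contra! hcon
    obtain ⟨⟨s, hs, hs0⟩, ⟨t, ht, ht0⟩⟩ := hcon
    obtain ⟨u, hu, hu0⟩ := (isPreconnected_Ioo (a := (0 : unitInterval)) (b := 1)).intermediate_value
      hs ht (Complex.continuous_im.comp hγ).continuousOn ⟨hs0, ht0⟩
    exact hne u hu hu0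
  refine hsign.imp (fun hp z hz hzx => ?_) fun hn z hz hzx hzy => ?_
  · obtain ⟨t, ht, rfl⟩ := hpar z hz (hzx x (Sym2.mem_mk_left _ _)) (hzx y (Sym2.mem_mk_right _ _))
    exact hp t ht
  · obtain ⟨t, ht, rfl⟩ := hpar z hz hzx hzy
    exact hn t ht

theorem exists_mem_arc_ne {x y : V} (hxy : G.graph.Adj x y) :
    ∃ z ∈ G.arc s(x, y), z ≠ G.pos x ∧ z ≠ G.pos y := by
  obtain ⟨γ, -, hinj, h0, h1, hr⟩ := G.arc_isArc x y hxy
  obtain ⟨t, ht0, ht1⟩ := exists_between (show (0 : unitInterval) < 1 from zero_lt_one)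
  refine ⟨γ t, hr ▸ Set.mem_range_self t, ?_, ?_⟩
  · rw [← h0]; exact hinj.ne ht0.ne'
  · rw [← h1]; exact hinj.ne ht1.ne

/-- The reflection exchanges the edges above and below the axis at a vertex of the axis. -/
theorem IsSymmetric.isAbove_mirror_iff (h : G.IsSymmetric) {x y : V} (hxy : G.graph.Adj x y)
    (hx : G.pos x ∈ axis) (hna : ¬ G.arc s(x, y) ⊆ axis) :
    G.IsAbove s(x, h.mirror y) ↔ ¬ G.IsAbove s(x, y) := by
  have hmx : h.mirror x = x := h.mirror_eq_self_iff.2 hx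
  obtain ⟨-, harc⟩ := h.adj_mirror_and_arc hxy
  rw [hmx] at harc
  constructor
  · intro ha hb
    obtain ⟨z, hz, hzx, hzy⟩ := exists_mem_arc_ne hxy
    have h1 := hb z hz (by intro u hu; rcases Sym2.mem_iff.1 hu with rfl | rfl <;> assumption)
    have h2 := ha (reflect z) (by rw [harc]; exact ⟨z, hz, rfl⟩) (by
      intro u hu
      rcases Sym2.mem_iff.1 hu with rfl | rfl
      · rw [← hmx, h.pos_mirror]
        exact reflect_involutive.injective.ne hzx
      · rw [h.pos_mirror]
        exact reflect_involutive.injective.ne hzy)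
    rw [reflect_im] at h2
    linarith
  · intro hb z hz hzu
    rw [harc] at hz
    obtain ⟨z, hz, rfl⟩ := hz
    have := (h.isAbove_or_below hxy hx hna).resolve_left hb z hz
      (by rintro rfl; exact hzu x (Sym2.mem_mk_left _ _) (by rw [← h.pos_mirror, hmx]))
      (by rintro rfl; exact hzu _ (Sym2.mem_mk_right _ _) (h.pos_mirror y).symm)
    rw [reflect_im]
    linarith

theorem IsSymmetricWeight.mirror {w : Sym2 V → ℝ} (hw : G.IsSymmetricWeight w)
    (h : G.IsSymmetric) {x y : V} (hxy : G.graph.Adj x y) :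
    w s(h.mirror x, h.mirror y) = w s(x, y) :=
  hw.reflect_eq _ hxy _ (h.adj_mirror_and_arc hxy).1 (h.adj_mirror_and_arc hxy).2

end PlaneGraph

end Geometry

/-! ### The law of the exit pattern -/

section Law

/-- A function on the discrete cube that does not see single flips is constant. -/
theorem eq_of_forall_update_not {ι α : Type*} [Fintype ι] [DecidableEq ι] {f : (ι → Bool) → α}
    (hf : ∀ ε i, f (Function.update ε i (!ε i)) = f ε) (ε ε' : ι → Bool) : f ε = f ε' := by
  have key : ∀ s : Finset ι, f (s.piecewise ε ε') = f ε' := by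
    intro s
    induction s using Finset.induction_on with
    | empty => simp
    | insert j s _ ih =>
      rw [Finset.piecewise_insert, ← ih]
      by_cases h : ε j = s.piecewise ε ε' j
      · rw [h, Function.update_eq_self]
      · rw [Bool.eq_not_of_ne h, hf]
  simpa using key Finset.univ

namespace PlaneGraph

variable {V : Type*} [Fintype V] {G : PlaneGraph V}

noncomputable instance (v : V) : Fintype (G.FreeAxisVertex v) :=
  haveI : Finite (G.FreeAxisVertex v) := Subtype.finite
  Fintype.ofFinite _

noncomputable instance (v : V) : DecidableEq (G.FreeAxisVertex v) := Classical.decEq _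

open Classical in
/-- The set of free axis vertices that the tree `T`, rooted at `v`, exits along an edge above the
axis, as a Boolean vector. -/
noncomputable def exitPattern (G : PlaneGraph V) (v : V) (T : SimpleGraph V)
    (x : G.FreeAxisVertex v) : Bool :=
  decide (∃ y, IsExit T v x.1 y ∧ G.IsAbove s(x.1, y))

theorem exitAbove_eq (v : V) (x : G.FreeAxisVertex v) (T : G.SpanningTree) :
    G.exitAbove v x.1 T = if G.exitPattern v T.1 x then 1 else 0 := by
  classical
  by_cases h : ∃ y, IsExit T.1 v x.1 y ∧ G.IsAbove s(x.1, y)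
  · exact (if_pos h).trans (if_pos (decide_eq_true h)).symm
  · exact (if_neg h).trans (if_neg fun h' => h (of_decide_eq_true h')).symm

/-- At a free axis vertex `x`, the step to `y` is on the side of the axis given by `ε x`. At any
other vertex, every step is allowed. -/
def StepAllowed (G : PlaneGraph V) (v : V) (ε : G.FreeAxisVertex v → Bool) (x y : V) : Prop :=
  ∀ z : G.FreeAxisVertex v, z.1 = x → (G.IsAbove s(x, y) ↔ ε z = true)

theorem exitPattern_eq_iff {v : V} {T : SimpleGraph V} (hT : T.IsTree)
    {ε : G.FreeAxisVertex v → Bool} :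
    G.exitPattern v T = ε ↔ ∀ x y, IsExit T v x y → G.StepAllowed v ε x y := by
  constructor
  · rintro rfl x y hxy z rfl
    simp only [exitPattern, decide_eq_true_eq]
    refine ⟨fun h => ⟨y, hxy, h⟩, ?_⟩
    rintro ⟨y', hy', h⟩
    rwa [hxy.unique hT hy']
  · intro h
    ext z
    obtain ⟨y, hy⟩ := exists_isExit hT z.2.1
    have hz := h _ _ hy z rfl
    rw [Bool.eq_iff_iff, ← hz]
    simp only [exitPattern, decide_eq_true_eq]
    refine ⟨?_, fun h => ⟨y, hy, h⟩⟩
    rintro ⟨y', hy', h⟩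
    rwa [hy.unique hT hy']

/-- The total weight of the spanning trees with a given exit pattern. -/
noncomputable def patternWeight (G : PlaneGraph V) (w : Sym2 V → ℝ) (v : V)
    (ε : G.FreeAxisVertex v → Bool) : ℝ :=
  ∑ T : G.SpanningTree with G.exitPattern v T.1 = ε, G.treeWeight w T

open Classical in
theorem patternWeight_eq_det (w : Sym2 V → ℝ) (v : V) (ε : G.FreeAxisVertex v → Bool) :
    G.patternWeight w v ε =
      (rootedLaplacian v (stepWeight G.graph w v (G.StepAllowed v ε))).det := by
  rw [← sum_tree_eq_det, patternWeight]
  refine Finset.sum_bij (fun T _ => T.1) ?_ ?_ ?_ ?_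
  · intro T hT
    exact Finset.mem_filter.2 ⟨Finset.mem_univ _, T.2,
      (exitPattern_eq_iff T.2.2).1 (Finset.mem_filter.1 hT).2⟩
  · intro T _ T' _ h
    exact Subtype.ext h
  · intro T hT
    obtain ⟨hT, hok⟩ := (Finset.mem_filter.1 hT).2
    exact ⟨⟨T, hT⟩, Finset.mem_filter.2 ⟨Finset.mem_univ _, (exitPattern_eq_iff hT.2).2 hok⟩, rfl⟩
  · intro T _
    rfl

/-- Reversing the prescribed side at one free axis vertex `i` reflects the row of `i`, which does
not affect the weight. -/
theorem patternWeight_update (hsymm : G.IsSymmetric) {w : Sym2 V → ℝ} (hw : G.IsSymmetricWeight w)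
    {v : V} (hv : G.pos v ∈ axis) (ε : G.FreeAxisVertex v → Bool) (i : G.FreeAxisVertex v) :
    G.patternWeight w v (Function.update ε i (!ε i)) = G.patternWeight w v ε := by
  classical
  rw [patternWeight_eq_det, patternWeight_eq_det]
  have hmi : hsymm.mirror i.1 = i.1 := hsymm.mirror_eq_self_iff.2 i.2.2.1
  have hmv : hsymm.mirror v = v := hsymm.mirror_eq_self_iff.2 hv
  refine det_rootedLaplacian_eq_of_reflect hsymm.mirror_involutive hmv ?_ i.2.1 hmi ?_ ?_
  · intro x hx y
    have hfree : ∀ z : G.FreeAxisVertex v, z.1 ≠ x ∧ z.1 ≠ hsymm.mirror x := by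
      intro z
      have hz : hsymm.mirror z.1 = z.1 := hsymm.mirror_eq_self_iff.2 z.2.2.1
      refine ⟨fun h => hx (h ▸ hz), fun h => hx ?_⟩
      rw [← h, ← hz, h, hsymm.mirror_involutive]
    have hxv : x ≠ v := by rintro rfl; exact hx hmv
    have hmxv : hsymm.mirror x ≠ v := by
      intro h; rw [← hsymm.mirror_involutive x, h, hmv] at hx; exact hx hmv
    have h1 : G.StepAllowed v ε x y := fun z hz => absurd hz (hfree z).1
    have h2 : G.StepAllowed v ε (hsymm.mirror x) (hsymm.mirror y) :=
      fun z hz => absurd hz (hfree z).2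
    simp only [stepWeight, hxv, hmxv, if_false, h1, h2, and_true, hsymm.adj_mirror_iff]
    split_ifs with hxy
    · exact hw.mirror hsymm hxy
    · rfl
  · intro y
    have hiff : ∀ (ε : G.FreeAxisVertex v → Bool) y,
        G.StepAllowed v ε i.1 y ↔ (G.IsAbove s(i.1, y) ↔ ε i = true) := by
      intro ε y
      refine ⟨fun h => h i rfl, fun h z hz => ?_⟩
      obtain rfl : z = i := Subtype.ext hz
      exact h
    have hadj : G.graph.Adj i.1 (hsymm.mirror y) ↔ G.graph.Adj i.1 y := by
      conv_lhs => rw [← hmi]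
      exact hsymm.adj_mirror_iff
    simp only [stepWeight, i.2.1, if_false, hiff, Function.update_self, hadj]
    by_cases hiy : G.graph.Adj i.1 y
    · have hab := hsymm.isAbove_mirror_iff hiy i.2.2.1 (i.2.2.2 _ hiy (Sym2.mem_mk_left _ _))
      have hwi : w s(i.1, hsymm.mirror y) = w s(i.1, y) := by
        have := hw.mirror hsymm hiy
        rwa [hmi] at this
      rw [hab, hwi]
      cases ε i <;> simp [hiy]
    · simp [hiy]
  · intro x hx y
    have : G.StepAllowed v (Function.update ε i (!ε i)) x y ↔ G.StepAllowed v ε x y := by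
      refine forall_congr' fun z => forall_congr' fun hz => ?_
      have hzi : z ≠ i := by rintro rfl; exact hx hz.symm
      rw [Function.update_of_ne hzi]
    simp only [stepWeight, this]

theorem treeWeight_pos {w : Sym2 V → ℝ} (hw : G.IsSymmetricWeight w) (T : G.SpanningTree) :
    0 < G.treeWeight w T := by
  classical
  exact Finset.prod_pos fun e he =>
    hw.pos e (SimpleGraph.edgeSet_mono T.2.1 (SimpleGraph.mem_edgeFinset.1 he))

theorem sum_treeWeight_pos (hconn : G.graph.Connected) {w : Sym2 V → ℝ}
    (hw : G.IsSymmetricWeight w) : 0 < ∑ T : G.SpanningTree, G.treeWeight w T := by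
  obtain ⟨T, hle, hT⟩ := hconn.exists_isTree_le
  exact Finset.sum_pos (fun T _ => treeWeight_pos hw T) ⟨⟨T, hle, hT⟩, Finset.mem_univ _⟩

theorem treeMeasure_setOf {w : Sym2 V → ℝ} (hw : G.IsSymmetricWeight w)
    (p : G.SpanningTree → Prop) [DecidablePred p] :
    G.treeMeasure w {T | p T} = ENNReal.ofReal
      ((∑ T : G.SpanningTree with p T, G.treeWeight w T) /
        ∑ T : G.SpanningTree, G.treeWeight w T) := by
  have hs : MeasurableSet {T | p T} := trivial
  rw [treeMeasure, Measure.finsetSum_apply, Finset.sum_div, Finset.sum_filter,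
    ENNReal.ofReal_sum_of_nonneg]
  · refine Finset.sum_congr rfl fun T _ => ?_
    rw [Measure.smul_apply, Measure.dirac_apply' _ hs]
    by_cases hT : p T <;> simp [hT]
  · intro T _
    split_ifs
    · exact div_nonneg (treeWeight_pos hw T).le
        (Finset.sum_nonneg fun T _ => (treeWeight_pos hw T).le)
    · exact le_rfl

theorem isProbabilityMeasure_treeMeasure (hconn : G.graph.Connected) {w : Sym2 V → ℝ}
    (hw : G.IsSymmetricWeight w) : IsProbabilityMeasure (G.treeMeasure w) := by
  refine ⟨?_⟩
  have h := treeMeasure_setOf hw fun _ : G.SpanningTree => True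
  rw [Set.ofPred_true] at h
  rw [h]
  simp [div_self (sum_treeWeight_pos hconn hw).ne']

/-- The exit pattern is uniformly distributed. -/
theorem treeMeasure_exitPattern_eq (hconn : G.graph.Connected) (hsymm : G.IsSymmetric)
    {w : Sym2 V → ℝ} (hw : G.IsSymmetricWeight w) {v : V} (hv : G.pos v ∈ axis)
    (ε : G.FreeAxisVertex v → Bool) :
    G.treeMeasure w {T | G.exitPattern v T.1 = ε} =
      (2⁻¹ : ENNReal) ^ Fintype.card (G.FreeAxisVertex v) := by
  have hZ := sum_treeWeight_pos hconn hw
  have hsum : ∑ ε', G.patternWeight w v ε' = ∑ T : G.SpanningTree, G.treeWeight w T :=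
    Finset.sum_fiberwise _ _ _
  have hcard : ∑ ε', G.patternWeight w v ε' =
      2 ^ Fintype.card (G.FreeAxisVertex v) * G.patternWeight w v ε := by
    rw [Finset.sum_congr rfl fun ε' _ =>
      eq_of_forall_update_not (patternWeight_update hsymm hw hv) ε' ε]
    simp
  rw [treeMeasure_setOf hw]
  have hnum : (∑ T : G.SpanningTree with G.exitPattern v T.1 = ε, G.treeWeight w T) =
      G.patternWeight w v ε := rfl
  rw [hnum, ← hsum, hcard]
  rw [← hsum, hcard] at hZ
  have hp : G.patternWeight w v ε ≠ 0 := fun h => by simp [h] at hZ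
  have h2 : G.patternWeight w v ε /
      (2 ^ Fintype.card (G.FreeAxisVertex v) * G.patternWeight w v ε) =
      (2⁻¹ : ℝ) ^ Fintype.card (G.FreeAxisVertex v) := by
    rw [inv_pow]; field_simp
  rw [h2, ENNReal.ofReal_pow (by norm_num), ENNReal.ofReal_inv_of_pos (by norm_num)]
  simp

/-- The probability of a product event. -/
theorem treeMeasure_forall_exitAbove_mem (hconn : G.graph.Connected) (hsymm : G.IsSymmetric)
    {w : Sym2 V → ℝ} (hw : G.IsSymmetricWeight w) {v : V} (hv : G.pos v ∈ axis)
    {B : G.FreeAxisVertex v → Set ℝ} (hB : ∀ x, MeasurableSet (B x)) :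
    G.treeMeasure w {T | ∀ x : G.FreeAxisVertex v, G.exitAbove v x.1 T ∈ B x} =
      ∏ x, bernoulliMeasure (1 : ℝ) 0 ⟨1 / 2, by norm_num, by norm_num⟩ (B x) := by
  classical
  have hset : {T : G.SpanningTree | ∀ x : G.FreeAxisVertex v, G.exitAbove v x.1 T ∈ B x} =
      ⋃ ε ∈ Finset.univ.filter (fun ε : G.FreeAxisVertex v → Bool =>
        ∀ x, (if ε x then (1 : ℝ) else 0) ∈ B x), {T | G.exitPattern v T.1 = ε} := by
    ext T
    simp [exitAbove_eq]
  have hber : ∀ x, bernoulliMeasure (1 : ℝ) 0 ⟨1 / 2, by norm_num, by norm_num⟩ (B x) =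
      ∑ b : Bool, if (if b then (1 : ℝ) else 0) ∈ B x then (2⁻¹ : ENNReal) else 0 := by
    intro x
    have h1 : (unitInterval.toNNReal ⟨1 / 2, by norm_num, by norm_num⟩ : ENNReal) = 2⁻¹ := by
      rw [← ENNReal.coe_ofNat, ← ENNReal.coe_inv two_ne_zero, ENNReal.coe_inj]
      ext; simp
    have h2 : (unitInterval.toNNReal (unitInterval.symm ⟨1 / 2, by norm_num, by norm_num⟩) :
        ENNReal) = 2⁻¹ := by
      rw [← ENNReal.coe_ofNat, ← ENNReal.coe_inv two_ne_zero, ENNReal.coe_inj]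
      ext; simp; norm_num
    rw [bernoulliMeasure_apply _ (hB x), h1, h2]
    by_cases h0 : (0 : ℝ) ∈ B x <;> by_cases h1 : (1 : ℝ) ∈ B x <;>
      simp [h0, h1, ENNReal.inv_two_add_inv_two]
  rw [hset, measure_biUnion_finset]
  · simp only [treeMeasure_exitPattern_eq hconn hsymm hw hv]
    rw [Finset.prod_congr rfl fun x _ => hber x, Finset.prod_univ_sum, Fintype.piFinset_univ,
      Finset.sum_filter]
    refine Finset.sum_congr rfl fun ε _ => ?_
    rw [Finset.prod_ite_zero]
    simp
  · intro ε _ ε' _ hne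
    exact Set.disjoint_left.2 fun T hT hT' => hne (hT.symm.trans hT')
  · exact fun _ _ => trivial

end PlaneGraph

end Law

theorem theorem6p4 {V : Type*} [Fintype V] (G : PlaneGraph V) (hconn : G.graph.Connected)
    (hsymm : G.IsSymmetric) (w : Sym2 V → ℝ) (hw : G.IsSymmetricWeight w)
    (v : V) (hv : G.pos v ∈ PlaneGraph.axis) (hv' : G.OnUnboundedFace v) :
    IsProbabilityMeasure (G.treeMeasure w) ∧
    iIndepFun (fun x : G.FreeAxisVertex v => G.exitAbove v x.1) (G.treeMeasure w) ∧
    ∀ x : G.FreeAxisVertex v,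
      HasLaw (G.exitAbove v x.1)
        (bernoulliMeasure (1 : ℝ) 0 ⟨1 / 2, by norm_num, by norm_num⟩) (G.treeMeasure w) := by
  classical
  have hprob := PlaneGraph.isProbabilityMeasure_treeMeasure hconn hw
  have hmeas : ∀ x : G.FreeAxisVertex v, Measurable (G.exitAbove v x.1) := fun _ _ _ => trivial
  have hlaw : ∀ x : G.FreeAxisVertex v, (G.treeMeasure w).map (G.exitAbove v x.1) =
      bernoulliMeasure (1 : ℝ) 0 ⟨1 / 2, by norm_num, by norm_num⟩ := by
    intro x
    ext B hB
    have h := PlaneGraph.treeMeasure_forall_exitAbove_mem hconn hsymm hw hv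
      (B := Function.update (fun _ => Set.univ) x B) (by
        intro y
        by_cases hy : y = x
        · subst hy; simpa using hB
        · simp [hy])
    rw [Finset.prod_eq_single x (by
      intro y _ hy
      rw [Function.update_of_ne hy]
      simp) (by simp), Function.update_self] at h
    rw [Measure.map_apply (hmeas x) hB, ← h]
    congr 1
    ext T
    refine ⟨fun hT y => ?_, fun hT => by simpa using hT x⟩
    by_cases hy : y = x
    · subst hy; simpa using hT
    · simp [hy]
  refine ⟨hprob, ?_, fun x => ⟨(hmeas x).aemeasurable, hlaw x⟩⟩
  rw [iIndepFun_iff_map_fun_eq_pi_map fun x => (hmeas x).aemeasurable]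
  symm
  have : ∀ x : G.FreeAxisVertex v,
      SigmaFinite ((G.treeMeasure w).map (G.exitAbove v x.1)) := by
    intro x
    have := Measure.isProbabilityMeasure_map (μ := G.treeMeasure w) (hmeas x).aemeasurable
    infer_instance
  refine Measure.pi_eq fun B hB => ?_
  rw [Measure.map_apply (measurable_pi_iff.2 hmeas) (MeasurableSet.univ_pi hB)]
  simp only [hlaw]
  rw [← PlaneGraph.treeMeasure_forall_exitAbove_mem hconn hsymm hw hv hB]
  congr 1
  ext T
  simp
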